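/- For each $n=1,2,\dots$ let $m_n\ge 1$ be an integer, let $X_n$ be a random variable with $\mathbb P(X_n=i)=p_n(i)>0$ for $i=1,\dots,m_n$, where $\sum_{i=1}^{m_n}p_n(i)=1$, and let $X_{n,1},\dots,X_{n,n}$ be i.i.d. random variables with the same distribution as $X_n$. Let $$\hat p_n(i)=\frac1n\sum_{k=1}^n I(X_{n,k}=i),\qquad \chi_n^2=n\sum_{i=1}^{m_n}\frac{(\hat p_n(i)-p_n(i))^2}{p_n(i)}$$ be the empirical frequencies and the Pearson chi-square statistic. Write $p_n^{-a}(X_n)$ for $(p_n(X_n))^{-a}$. Assume that, as $n\to\infty$, $m_n\to\infty$, $$\text{(C)}\qquad \frac{1}{m_n n}\,\mathbb{V}\mathrm{ar}\,\bigl(p_n^{-1}(X_n)\bigr)\to 0 ,\qquad\text{and}\qquad \frac{n}{\sqrt{m_n}}\to\infty ,$$ and that for some $\delta>0$ $$\sup_{n\ge1}\; m_n^{-(1+\delta)}\,\mathbb E\,p_n^{-(1+\delta)}(X_n)<\infty .$$ Then $$\frac{\chi_n^2-m_n}{\sqrt{2m_n}}\ \xrightarrow{\,d\,}\ N,\qquad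 N\sim \mathrm{Norm}(0,1),$$ as $n\to\infty$. -/

import Mathlib

open MeasureTheory ProbabilityTheory Filter Topology

noncomputable section

/-- Empirical frequency of the class `i` in the sample `X 0, …, X (n - 1)`. -/
def empFreq {n m : ℕ} {Ω : Type*} (X : Fin n → Ω → Fin m) (i : Fin m) (ω : Ω) : ℝ :=
  (n : ℝ)⁻¹ * ∑ k : Fin n, if X k ω = i then (1 : ℝ) else 0

/-- Pearson's chi-square statistic of the sample `X 0, …, X (n - 1)` for the class
probabilities `p`. -/
def pearsonChiSq {n m : ℕ} {Ω : Type*} (p : Fin m → ℝ) (X : Fin n → Ω → Fin m) (ω : Ω) : ℝ :=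
  (n : ℝ) * ∑ i : Fin m, (empFreq X i ω - p i) ^ 2 / p i

end

/-!
Up to centring, `χ²` is `1 / n` times the quadratic form of the sample in the kernel
`h(a, b) = 1{a = b} / p(a) - 1`. The diagonal of the form is a sum of `n` independent copies of
`p⁻¹ - 1`, negligible after centring by condition (C), so let `W = (c / 2) ∑_{k ≠ l} h(X_k, X_l)`
with `c² = 2 / (n² m)`. The part of `W` involving `X_k` is `T_k = c ∑_{l ≠ k} h(X_k, X_l)`. Given
the other observations, `T_k` has mean zero, and since `h` is a projection kernel its conditional
variance is `c²` times the quadratic form of the other observations, which concentrates around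
`2 / n`. As `W = (1 / 2) ∑_k T_k`, expanding `exp(isW)` in each `T_k` gives
`E[W exp(isW)] ≈ is E[exp(isW)]`, so the characteristic function `φ` of `W` nearly solves
`φ' = -sφ` and is close to `exp(-s² / 2)`. The Lindeberg-type remainder is controlled by fourth
moments of `T_k` on the classes with `p⁻¹ ≤ (m + n) / ε`, and on the remaining rare classes by
second moments and `E p⁻² = m² + Var p⁻¹`.
-/

section CharFun

open Complex (I)

theorem norm_exp_ofReal_mul_I_sub_one_le (v : ℝ) : ‖Complex.exp (v * I) - 1‖ ≤ |v| := by
  rw [mul_comm]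
  exact Real.norm_exp_I_mul_ofReal_sub_one_le

theorem norm_exp_ofReal_mul_I_sub_one_sub_le (v : ℝ) :
    ‖Complex.exp (v * I) - 1 - v * I‖ ≤ 2 * min |v| (v ^ 2) := by
  have hnorm : ‖(v : ℂ) * I‖ = |v| := by simp
  rcases le_total |v| 1 with hv | hv
  · have hsq : v ^ 2 ≤ |v| := by
      rw [← sq_abs]
      exact pow_le_of_le_one (abs_nonneg v) hv two_ne_zero
    have h := Complex.norm_exp_sub_one_sub_id_le (hnorm.trans_le hv)
    rw [hnorm, sq_abs] at h
    rw [min_eq_right hsq]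
    linarith [sq_nonneg v]
  · have hsq : |v| ≤ v ^ 2 := by
      rw [← sq_abs]
      exact le_self_pow₀ hv two_ne_zero
    have h := norm_sub_le (Complex.exp (v * I) - 1) (v * I)
    rw [hnorm] at h
    rw [min_eq_left hsq]
    linarith [norm_exp_ofReal_mul_I_sub_one_le v]

theorem abs_le_one_add_sq (s : ℝ) : |s| ≤ 1 + s ^ 2 := by
  nlinarith [sq_nonneg (|s| - 1), sq_abs s]

theorem abs_mul_min_abs_mul_le (s T : ℝ) :
    |T| * min |s * T| ((s * T) ^ 2) ≤ (1 + s ^ 2) * min (T ^ 2) (|T| ^ 3) := by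
  rw [mul_min_of_nonneg _ _ (abs_nonneg T), mul_min_of_nonneg _ _ (by positivity)]
  refine min_le_min ?_ ?_
  · calc |T| * |s * T| = |s| * T ^ 2 := by
          rw [abs_mul, ← sq_abs T]
          ring
      _ ≤ (1 + s ^ 2) * T ^ 2 := by
          gcongr
          exact abs_le_one_add_sq s
  · calc |T| * (s * T) ^ 2 = s ^ 2 * |T| ^ 3 := by
          rw [← sq_abs, abs_mul, mul_pow, sq_abs]
          ring
      _ ≤ (1 + s ^ 2) * |T| ^ 3 := by
          gcongr
          linarith

variable {Ω : Type*} [MeasurableSpace Ω] {P : Measure Ω}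

theorem integrable_mul_exp_ofReal_mul_I {T U : Ω → ℝ} (hT : Integrable T P)
    (hU : AEMeasurable U P) : Integrable (fun ω => (T ω : ℂ) * Complex.exp (U ω * I)) P :=
  hT.ofReal.mul_bdd (c := 1) (by fun_prop) (by simp)

-- `exp (s(u + T)I)` is expanded around `exp (suI)`, to first order in the first term on the left
-- and to order zero in the second; the subtracted bracket has mean zero in the application.
theorem norm_steinRemainder_le {s σ2 : ℝ} (hσ2 : 0 ≤ σ2) (u T τ : ℝ) :
    ‖(T : ℂ) * Complex.exp ((s * (u + T) : ℝ) * I)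
        - s * σ2 * I * Complex.exp ((s * (u + T) : ℝ) * I)
        - (T * Complex.exp ((s * u : ℝ) * I)
          + s * I * (((T ^ 2 : ℝ) : ℂ) * Complex.exp ((s * u : ℝ) * I)
            - τ * Complex.exp ((s * u : ℝ) * I)))‖
      ≤ (1 + s ^ 2) * (2 * min (T ^ 2) (|T| ^ 3) + |τ - σ2| + σ2 * |T|) := by
  set e : ℂ := Complex.exp ((s * u : ℝ) * I)
  set v : ℝ := s * T with hv
  have he : ‖e‖ = 1 := Complex.norm_exp_ofReal_mul_I _
  have hexp : Complex.exp ((s * (u + T) : ℝ) * I) = e * Complex.exp (v * I) := by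
    rw [← Complex.exp_add]
    push_cast [hv]
    ring_nf
  have hsplit : (T : ℂ) * (e * Complex.exp (v * I)) - s * σ2 * I * (e * Complex.exp (v * I))
        - (T * e + s * I * (((T ^ 2 : ℝ) : ℂ) * e - τ * e))
      = T * e * (Complex.exp (v * I) - 1 - v * I) + s * I * e * (τ - σ2 : ℝ)
        - s * σ2 * I * e * (Complex.exp (v * I) - 1) := by
    push_cast [hv]
    ring
  rw [hexp, hsplit]
  calc _ ≤ |T| * ‖Complex.exp (v * I) - 1 - v * I‖ + |s| * |τ - σ2|
        + |s| * σ2 * ‖Complex.exp (v * I) - 1‖ := by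
        refine (norm_sub_le _ _).trans (add_le_add ((norm_add_le _ _).trans_eq ?_) (le_of_eq ?_))
        <;> simp [he, -Complex.ofReal_sub, abs_of_nonneg hσ2]
    _ ≤ |T| * (2 * min |v| (v ^ 2)) + |s| * |τ - σ2| + |s| * σ2 * |v| := by
        gcongr
        · exact norm_exp_ofReal_mul_I_sub_one_sub_le v
        · exact norm_exp_ofReal_mul_I_sub_one_le v
    _ = 2 * (|T| * min |v| (v ^ 2)) + |s| * |τ - σ2| + s ^ 2 * (σ2 * |T|) := by
        rw [hv, abs_mul, ← sq_abs s]
        ring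
    _ ≤ 2 * ((1 + s ^ 2) * min (T ^ 2) (|T| ^ 3)) + (1 + s ^ 2) * |τ - σ2|
        + (1 + s ^ 2) * (σ2 * |T|) := by
        gcongr 2 * ?_ + ?_ * _ + ?_
        · exact abs_mul_min_abs_mul_le s T
        · exact abs_le_one_add_sq s
        · gcongr
          linarith
    _ = _ := by ring

-- `hfirst` and `hsecond` are what `E[T | U] = 0` and `E[T² | U] = E[τ | U]` give at `exp (sUI)`.
theorem norm_integral_mul_exp_sub_le [IsProbabilityMeasure P] {U T τ : Ω → ℝ} {s σ2 : ℝ}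
    (hU : AEMeasurable U P) (hT : MemLp T 2 P) (hτ : Integrable τ P) (hσ2 : 0 ≤ σ2)
    (hfirst : ∫ ω, (T ω : ℂ) * Complex.exp ((s * U ω : ℝ) * I) ∂P = 0)
    (hsecond : ∫ ω, ((T ω ^ 2 : ℝ) : ℂ) * Complex.exp ((s * U ω : ℝ) * I) ∂P
      = ∫ ω, (τ ω : ℂ) * Complex.exp ((s * U ω : ℝ) * I) ∂P) :
    ‖∫ ω, (T ω : ℂ) * Complex.exp ((s * (U ω + T ω) : ℝ) * I) ∂P
        - s * σ2 * I * ∫ ω, Complex.exp ((s * (U ω + T ω) : ℝ) * I) ∂P‖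
      ≤ (1 + s ^ 2) * ∫ ω, (2 * min (T ω ^ 2) (|T ω| ^ 3) + |τ ω - σ2| + σ2 * |T ω|) ∂P := by
  set u : Ω → ℂ := fun ω => Complex.exp ((s * U ω : ℝ) * I)
  set w : Ω → ℂ := fun ω => Complex.exp ((s * (U ω + T ω) : ℝ) * I)
  have hT1 : Integrable T P := hT.integrable one_le_two
  have hTm := hT1.aemeasurable
  have hsU : AEMeasurable (fun ω => s * U ω) P := hU.const_mul s
  have hsW : AEMeasurable (fun ω => s * (U ω + T ω)) P := (hU.add hTm).const_mul s
  have hw : Integrable w P :=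
    .of_bound (C := 1) (by fun_prop) (.of_forall fun ω => (Complex.norm_exp_ofReal_mul_I _).le)
  have hTu : Integrable (fun ω => T ω * u ω) P := integrable_mul_exp_ofReal_mul_I hT1 hsU
  have hTw : Integrable (fun ω => T ω * w ω) P := integrable_mul_exp_ofReal_mul_I hT1 hsW
  have hTTu : Integrable (fun ω => ((T ω ^ 2 : ℝ) : ℂ) * u ω) P :=
    integrable_mul_exp_ofReal_mul_I hT.integrable_sq hsU
  have hτu : Integrable (fun ω => τ ω * u ω) P := integrable_mul_exp_ofReal_mul_I hτ hsU
  have hdiff : Integrable (fun ω => s * I * (((T ω ^ 2 : ℝ) : ℂ) * u ω - τ ω * u ω)) P :=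
    (hTTu.sub hτu).const_mul _
  have hzero : ∫ ω, (T ω * u ω + s * I * (((T ω ^ 2 : ℝ) : ℂ) * u ω - τ ω * u ω)) ∂P = 0 := by
    rw [integral_add hTu hdiff, integral_const_mul, integral_sub hTTu hτu, hfirst, hsecond,
      sub_self, mul_zero, add_zero]
  have hmin : Integrable (fun ω => min (T ω ^ 2) (|T ω| ^ 3)) P :=
    hT.integrable_sq.mono' (by fun_prop) (.of_forall fun ω => by
      rw [Real.norm_of_nonneg (by positivity)]
      exact min_le_left _ _)
  have hdecomp : ∫ ω, T ω * w ω ∂P - s * σ2 * I * ∫ ω, w ω ∂P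
      = ∫ ω, (T ω * w ω - s * σ2 * I * w ω
          - (T ω * u ω + s * I * (((T ω ^ 2 : ℝ) : ℂ) * u ω - τ ω * u ω))) ∂P := by
    rw [integral_sub, integral_sub hTw (hw.const_mul _), integral_const_mul, hzero, sub_zero]
    exacts [hTw.sub (hw.const_mul _), hTu.add hdiff]
  rw [hdecomp, ← integral_const_mul]
  exact norm_integral_le_of_norm_le
    ((((hmin.const_mul 2).add (hτ.sub (integrable_const σ2)).abs).add
      (hT1.abs.const_mul σ2)).const_mul _)
    (.of_forall fun ω => norm_steinRemainder_le hσ2 _ _ _)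

theorem norm_sub_mul_exp_neg_sq_div_two_le {y y' : ℝ → ℂ} {t R : ℝ}
    (hy : ∀ s, HasDerivAt y (y' s) s) (hR : ∀ s, |s| ≤ |t| → ‖y' s + s * y s‖ ≤ R) :
    ‖y t - y 0 * Real.exp (-t ^ 2 / 2)‖ ≤ R * |t| := by
  have hderiv (s : ℝ) : HasDerivAt (fun s : ℝ => y s * Real.exp (s ^ 2 / 2))
      ((y' s + s * y s) * Real.exp (s ^ 2 / 2)) s := by
    have hexp : HasDerivAt (fun s : ℝ => Real.exp (s ^ 2 / 2)) (Real.exp (s ^ 2 / 2) * s) s := by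
      simpa using (((hasDerivAt_id s).pow 2).div_const 2).exp
    refine ((hy s).fun_mul hexp.ofReal_comp).congr_deriv ?_
    push_cast
    ring
  have hbound : ∀ s ∈ Metric.closedBall (0 : ℝ) |t|,
      ‖(y' s + s * y s) * Real.exp (s ^ 2 / 2)‖ ≤ R * Real.exp (t ^ 2 / 2) := by
    intro s hs
    rw [mem_closedBall_zero_iff, Real.norm_eq_abs] at hs
    rw [norm_mul, Complex.norm_real, Real.norm_of_nonneg (Real.exp_pos _).le]
    have := sq_le_sq.2 hs
    gcongr
    · exact (norm_nonneg _).trans (hR s hs)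
    · exact hR s hs
  have hmean := (convex_closedBall (0 : ℝ) |t|).norm_image_sub_le_of_norm_hasDerivWithin_le
    (fun s _ => (hderiv s).hasDerivWithinAt) hbound (Metric.mem_closedBall_self (abs_nonneg t))
    (y := t) (by simp)
  have hfactor : y t - y 0 * Real.exp (-t ^ 2 / 2)
      = (y t * Real.exp (t ^ 2 / 2) - y 0 * Real.exp (0 ^ 2 / 2)) * Real.exp (-t ^ 2 / 2) := by
    rw [sub_mul, mul_assoc, ← Complex.ofReal_mul, ← Real.exp_add, neg_div, add_neg_cancel]
    simp
  calc ‖y t - y 0 * Real.exp (-t ^ 2 / 2)‖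
      ≤ R * Real.exp (t ^ 2 / 2) * ‖t - 0‖ * Real.exp (-t ^ 2 / 2) := by
        rw [hfactor, norm_mul, Complex.norm_real, Real.norm_of_nonneg (Real.exp_pos _).le]
        gcongr
    _ = R * |t| * (Real.exp (t ^ 2 / 2) * Real.exp (-t ^ 2 / 2)) := by
        rw [sub_zero, Real.norm_eq_abs]
        ring
    _ = R * |t| := by rw [← Real.exp_add, neg_div, add_neg_cancel, Real.exp_zero, mul_one]

theorem hasDerivAt_charFun_real {ν : Measure ℝ} [IsFiniteMeasure ν] (hν : Integrable id ν) (s : ℝ) :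
    HasDerivAt (charFun ν) (I * ∫ x, x * Complex.exp (s * x * I) ∂ν) s := by
  have hmem : MemLp id ((1 : ℕ) : ENNReal) ν := by simpa [memLp_one_iff_integrable] using hν
  have hderiv := iteratedDeriv_charFun (t := s) hmem
  simp only [iteratedDeriv_one, pow_one] at hderiv
  rw [← hderiv]
  exact ((contDiff_charFun hmem).differentiable (by simp)).differentiableAt.hasDerivAt

theorem norm_charFun_map_sub_exp_le [IsProbabilityMeasure P] {W : Ω → ℝ} (hW : Integrable W P)
    {t R : ℝ} (hR : ∀ s, |s| ≤ |t| → ‖∫ ω, (W ω : ℂ) * Complex.exp ((s * W ω : ℝ) * I) ∂P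
      - s * I * ∫ ω, Complex.exp ((s * W ω : ℝ) * I) ∂P‖ ≤ R) :
    ‖charFun (P.map W) t - Real.exp (-t ^ 2 / 2)‖ ≤ R * |t| := by
  have hWm := hW.aemeasurable
  have := Measure.isProbabilityMeasure_map hWm
  have hν : Integrable id (P.map W) :=
    (integrable_map_measure aestronglyMeasurable_id hWm).2 hW
  have hODE := norm_sub_mul_exp_neg_sq_div_two_le (t := t) (R := R)
    (hasDerivAt_charFun_real hν) fun s hs => ?_
  · simpa using hODE
  · refine le_trans (le_of_eq ?_) (hR s hs)
    rw [charFun_apply_real, integral_map hWm (by fun_prop), integral_map hWm (by fun_prop),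
      ← one_mul ‖_ - _‖, ← Complex.norm_I, ← norm_mul, mul_sub]
    push_cast
    congr 1
    rw [← mul_assoc, mul_left_comm I, Complex.I_mul_I]
    ring

end CharFun

section Resampling

variable {ι : Type*} [Fintype ι] [DecidableEq ι] {α : ι → Type*} [∀ i, MeasurableSpace (α i)]
  {μ : ∀ i, Measure (α i)} [∀ i, IsProbabilityMeasure (μ i)]
  {E : Type*} [NormedAddCommGroup E] [NormedSpace ℝ E]

theorem measurePreserving_update_pi (k : ι) :
    MeasurePreserving (fun z : (∀ i, α i) × α k => Function.update z.1 k z.2)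
      ((Measure.pi μ).prod (μ k)) (Measure.pi μ) := by
  have hmeas : Measurable fun z : (∀ i, α i) × α k => Function.update z.1 k z.2 :=
    measurable_pi_lambda _ fun i => by
      rcases eq_or_ne i k with rfl | hik
      · simpa using measurable_snd
      · simp only [Function.update_of_ne hik]
        fun_prop
  refine ⟨hmeas, (Measure.pi_eq fun s hs => ?_).symm⟩
  have hpre : (fun z : (∀ i, α i) × α k => Function.update z.1 k z.2) ⁻¹' Set.univ.pi s
      = (Set.univ.pi (Function.update s k Set.univ)) ×ˢ s k := by
    ext ⟨x, a⟩
    simp only [Set.mem_preimage, Set.mem_univ_pi, Set.mem_prod]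
    refine ⟨fun h => ⟨fun i => ?_, by simpa using h k⟩, fun h i => ?_⟩ <;>
      rcases eq_or_ne i k with rfl | hik
    · simp
    · simpa [hik] using h i
    · simpa using h.2
    · simpa [hik] using h.1 i
  rw [Measure.map_apply hmeas (.univ_pi hs), hpre, Measure.prod_prod, Measure.pi_pi,
    ← Finset.mul_prod_erase _ _ (Finset.mem_univ k),
    ← Finset.mul_prod_erase _ (fun i => μ i (s i)) (Finset.mem_univ k)]
  rw [Function.update_self, measure_univ, one_mul, mul_comm]
  congr 1
  refine Finset.prod_congr rfl fun i hi => ?_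
  rw [Function.update_of_ne (Finset.ne_of_mem_erase hi)]

theorem integral_pi_eq_integral_update {F : (∀ i, α i) → E} (hF : Integrable F (Measure.pi μ))
    (k : ι) :
    ∫ x, F x ∂Measure.pi μ = ∫ x, ∫ a, F (Function.update x k a) ∂μ k ∂Measure.pi μ := by
  have hmp := measurePreserving_update_pi (μ := μ) k
  have hint : Integrable (fun z : (∀ i, α i) × α k => F (Function.update z.1 k z.2))
      ((Measure.pi μ).prod (μ k)) := hmp.integrable_comp_of_integrable hF
  rw [← hmp.map_eq] at hF
  rw [← integral_prod _ hint, ← integral_map hmp.aemeasurable hF.aestronglyMeasurable, hmp.map_eq]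

theorem integral_pi_smul_of_update_eq [CompleteSpace E] {A : (∀ i, α i) → E}
    {B : (∀ i, α i) → ℝ} {k : ι}
    (hA : ∀ x a, A (Function.update x k a) = A x)
    (hAB : Integrable (fun x => B x • A x) (Measure.pi μ)) :
    ∫ x, B x • A x ∂Measure.pi μ
      = ∫ x, (∫ a, B (Function.update x k a) ∂μ k) • A x ∂Measure.pi μ := by
  rw [integral_pi_eq_integral_update hAB k]
  simp only [hA, integral_smul_const]

theorem integral_pi_mul_eval_of_update_eq {A : (∀ i, α i) → ℝ} {k : ι}
    (hA : ∀ x a, A (Function.update x k a) = A x) {f : α k → ℝ}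
    (hAf : Integrable (fun x => A x * f (x k)) (Measure.pi μ)) :
    ∫ x, A x * f (x k) ∂Measure.pi μ = (∫ x, A x ∂Measure.pi μ) * ∫ a, f a ∂μ k := by
  simp only [integral_pi_eq_integral_update hAf k, hA, Function.update_self, integral_const_mul,
    integral_mul_const]

theorem integral_pi_eval_of_update_eq {k : ι} {F : α k → (∀ i, α i) → E}
    (hF : ∀ b x a, F b (Function.update x k a) = F b x)
    (hint : Integrable (fun x => F (x k) x) (Measure.pi μ)) :
    ∫ x, F (x k) x ∂Measure.pi μ = ∫ a, ∫ x, F a x ∂Measure.pi μ ∂μ k := by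
  have hprod : Integrable (fun z : (∀ i, α i) × α k => F z.2 z.1) ((Measure.pi μ).prod (μ k)) := by
    simpa [Function.comp_def, hF] using
      (measurePreserving_update_pi (μ := μ) k).integrable_comp_of_integrable hint
  rw [integral_pi_eq_integral_update hint k]
  simp only [hF, Function.update_self]
  exact integral_integral_swap hprod

end Resampling

section CenteredSums

theorem sum_eval_update_of_notMem {ι α M : Type*} [DecidableEq ι] [AddCommMonoid M] {S : Finset ι}
    {k : ι} (hk : k ∉ S) (g : α → M) (x : ι → α) (a : α) :
    ∑ l ∈ S, g (Function.update x k a l) = ∑ l ∈ S, g (x l) :=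
  Finset.sum_congr rfl fun l hl => by
    rw [Function.update_of_ne (ne_of_mem_of_not_mem hl hk)]

variable {ι : Type*} [Fintype ι] {α : Type*} [Finite α] [MeasurableSpace α]
  [MeasurableSingletonClass α] {μ : Measure α} [IsProbabilityMeasure μ] {f : α → ℝ}

theorem integral_pi_sum (f : α → ℝ) (S : Finset ι) :
    ∫ x, ∑ l ∈ S, f (x l) ∂Measure.pi (fun _ : ι => μ) = S.card * ∫ a, f a ∂μ := by
  rw [integral_finsetSum _ fun _ _ => .of_finite]
  simp [integral_comp_eval (μ := fun _ : ι => μ) (f := f) (.of_discrete)]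

theorem integral_pi_comp_sum_mul_eval {S : Finset ι} {k : ι} (hk : k ∉ S) (φ : ℝ → ℝ)
    (g : α → ℝ) :
    ∫ x, φ (∑ l ∈ S, f (x l)) * g (x k) ∂Measure.pi (fun _ : ι => μ)
      = (∫ x, φ (∑ l ∈ S, f (x l)) ∂Measure.pi (fun _ : ι => μ)) * ∫ a, g a ∂μ := by
  classical
  exact integral_pi_mul_eval_of_update_eq (μ := fun _ => μ)
    (fun x a => by rw [sum_eval_update_of_notMem hk]) .of_finite

theorem integral_pi_sum_sq (hf : ∫ a, f a ∂μ = 0) (S : Finset ι) :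
    ∫ x, (∑ l ∈ S, f (x l)) ^ 2 ∂Measure.pi (fun _ : ι => μ) = S.card * ∫ a, f a ^ 2 ∂μ := by
  classical
  induction S using Finset.induction_on with
  | empty => simp
  | insert k S hk ih =>
    have hcross := integral_pi_comp_sum_mul_eval (μ := μ) (f := f) hk id f
    have hlast := integral_pi_comp_sum_mul_eval (μ := μ) (f := f) hk (fun _ => 1) fun a => f a ^ 2
    simp only [id, hf, mul_zero] at hcross
    simp only [one_mul, integral_const, probReal_univ, one_smul] at hlast
    have hexpand (x : ι → α) : (∑ l ∈ insert k S, f (x l)) ^ 2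
        = (∑ l ∈ S, f (x l)) ^ 2 + 2 * ((∑ l ∈ S, f (x l)) * f (x k)) + f (x k) ^ 2 := by
      rw [Finset.sum_insert hk]
      ring
    simp only [hexpand]
    rw [integral_add .of_finite .of_finite, integral_add .of_finite .of_finite,
      integral_const_mul, hcross, hlast, ih, Finset.card_insert_of_notMem hk]
    push_cast
    ring

theorem integral_pi_sum_pow_four (hf : ∫ a, f a ∂μ = 0) (S : Finset ι) :
    ∫ x, (∑ l ∈ S, f (x l)) ^ 4 ∂Measure.pi (fun _ : ι => μ)
      = S.card * ∫ a, f a ^ 4 ∂μ + 3 * S.card * (S.card - 1) * (∫ a, f a ^ 2 ∂μ) ^ 2 := by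
  classical
  induction S using Finset.induction_on with
  | empty => simp
  | insert k S hk ih =>
    have hmixed (i j : ℕ) := integral_pi_comp_sum_mul_eval (μ := μ) (f := f) hk (· ^ i) (f · ^ j)
    have h31 := hmixed 3 1
    have h22 := hmixed 2 2
    have h13 := hmixed 1 3
    have h04 := hmixed 0 4
    simp only [pow_one, hf, mul_zero] at h31
    rw [integral_pi_sum_sq hf] at h22
    simp only [pow_one, integral_pi_sum, hf, mul_zero, zero_mul] at h13
    simp only [pow_zero, one_mul, integral_const, probReal_univ, one_smul] at h04
    have hexpand (x : ι → α) : (∑ l ∈ insert k S, f (x l)) ^ 4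
        = (∑ l ∈ S, f (x l)) ^ 4 + 4 * ((∑ l ∈ S, f (x l)) ^ 3 * f (x k))
          + 6 * ((∑ l ∈ S, f (x l)) ^ 2 * f (x k) ^ 2)
          + 4 * ((∑ l ∈ S, f (x l)) * f (x k) ^ 3) + f (x k) ^ 4 := by
      rw [Finset.sum_insert hk]
      ring
    simp only [hexpand]
    repeat rw [integral_add .of_finite .of_finite]
    simp only [integral_const_mul]
    rw [h31, h22, h13, h04, ih, Finset.card_insert_of_notMem hk]
    push_cast
    ring

end CenteredSums

section PearsonKernel

variable {α : Type*} [MeasurableSpace α]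

/-- The reciprocal class probability `p⁻¹` of the law `μ`, as a random variable on `(α, μ)`. -/
noncomputable def invProb (μ : Measure α) (a : α) : ℝ :=
  (μ.real {a})⁻¹

/-- The kernel `h` for which `∑ k, ∑ l, h (x k) (x l)` is `n` times the chi-square statistic of the
sample `x`. -/
noncomputable def pearsonKernel [DecidableEq α] (μ : Measure α) (a b : α) : ℝ :=
  (if a = b then invProb μ a else 0) - 1

variable {μ : Measure α}

theorem pearsonKernel_comm [DecidableEq α] (a b : α) :
    pearsonKernel μ a b = pearsonKernel μ b a := by
  rcases eq_or_ne a b with rfl | hab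
  · rfl
  · simp [pearsonKernel, hab, hab.symm]

theorem pearsonKernel_self [DecidableEq α] (a : α) : pearsonKernel μ a a = invProb μ a - 1 := by
  simp [pearsonKernel]

variable [IsProbabilityMeasure μ]

theorem one_le_invProb (hμ : ∀ a, 0 < μ.real {a}) (a : α) : 1 ≤ invProb μ a :=
  (one_le_inv₀ (hμ a)).2 measureReal_le_one

variable [MeasurableSingletonClass α]

section Fintype

variable [Fintype α]

theorem integral_invProb (hμ : ∀ a, 0 < μ.real {a}) :
    ∫ a, invProb μ a ∂μ = Fintype.card α := by
  rw [integral_fintype .of_finite]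
  simp [invProb, mul_inv_cancel₀ (hμ _).ne']

theorem integral_invProb_sub_card (hμ : ∀ a, 0 < μ.real {a}) :
    ∫ a, (invProb μ a - Fintype.card α) ∂μ = 0 := by
  rw [integral_sub .of_finite .of_finite, integral_invProb hμ]
  simp

theorem integral_invProb_sub_card_sq (hμ : ∀ a, 0 < μ.real {a}) :
    ∫ a, (invProb μ a - Fintype.card α) ^ 2 ∂μ = Var[invProb μ; μ] := by
  rw [variance_eq_integral (measurable_of_finite _).aemeasurable, integral_invProb hμ]

theorem integral_invProb_sq (hμ : ∀ a, 0 < μ.real {a}) :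
    ∫ a, invProb μ a ^ 2 ∂μ = (Fintype.card α : ℝ) ^ 2 + Var[invProb μ; μ] := by
  rw [variance_eq_sub .of_discrete, integral_invProb hμ]
  simp

end Fintype

variable [Finite α] [DecidableEq α]

-- The integral operator with kernel `h` is the projection onto the mean-zero functions of `L²(μ)`.
theorem integral_pearsonKernel_mul (hμ : ∀ a, 0 < μ.real {a}) (b : α) (f : α → ℝ) :
    ∫ a, pearsonKernel μ b a * f a ∂μ = f b - ∫ a, f a ∂μ := by
  have hpoint : ∫ a, (if b = a then invProb μ b else 0) * f a ∂μ = f b := by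
    have := Fintype.ofFinite α
    rw [integral_fintype .of_finite]
    simp [invProb, mul_inv_cancel_left₀ (hμ b).ne']
  simp only [pearsonKernel, sub_mul, one_mul]
  rw [integral_sub .of_finite .of_finite, hpoint]

theorem integral_pearsonKernel (hμ : ∀ a, 0 < μ.real {a}) (b : α) :
    ∫ a, pearsonKernel μ b a ∂μ = 0 := by
  simpa using integral_pearsonKernel_mul hμ b fun _ => 1

theorem integral_pearsonKernel_mul_pearsonKernel (hμ : ∀ a, 0 < μ.real {a}) (b c : α) :
    ∫ a, pearsonKernel μ a b * pearsonKernel μ a c ∂μ = pearsonKernel μ b c := by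
  simp only [pearsonKernel_comm _ b]
  rw [integral_pearsonKernel_mul hμ]
  simp only [pearsonKernel_comm _ c]
  rw [integral_pearsonKernel hμ, sub_zero]

theorem integral_pearsonKernel_sq (hμ : ∀ a, 0 < μ.real {a}) (b : α) :
    ∫ a, pearsonKernel μ b a ^ 2 ∂μ = invProb μ b - 1 := by
  simp only [pow_two]
  rw [integral_pearsonKernel_mul hμ, integral_pearsonKernel hμ, pearsonKernel_self, sub_zero]

theorem integral_pearsonKernel_pow_four_le (hμ : ∀ a, 0 < μ.real {a}) (b : α) :
    ∫ a, pearsonKernel μ b a ^ 4 ∂μ ≤ invProb μ b ^ 3 := by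
  have hstep (j : ℕ) : ∫ a, pearsonKernel μ b a ^ (j + 1) ∂μ
      = (invProb μ b - 1) ^ j - ∫ a, pearsonKernel μ b a ^ j ∂μ := by
    simp only [pow_succ']
    rw [integral_pearsonKernel_mul hμ, pearsonKernel_self]
  rw [hstep 3, hstep 2, integral_pearsonKernel_sq hμ]
  nlinarith [sq_nonneg (4 * invProb μ b - 3)]

end PearsonKernel

section KernelForms

variable {ι : Type*} {α : Type*} [MeasurableSpace α] [DecidableEq α]

/-- The sum `∑ l ∈ S, h b (x l)` of the Pearson kernel over the observations indexed by `S`. -/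
noncomputable def kernelSum (μ : Measure α) (S : Finset ι) (b : α) (x : ι → α) : ℝ :=
  ∑ l ∈ S, pearsonKernel μ b (x l)

/-- The quadratic form `∑ k ∈ S, ∑ l ∈ S, h (x k) (x l)`. -/
noncomputable def kernelForm (μ : Measure α) (S : Finset ι) (x : ι → α) : ℝ :=
  ∑ k ∈ S, kernelSum μ S (x k) x

/-- The off-diagonal part `∑ k ∈ S, ∑ l ∈ S \ {k}, h (x k) (x l)` of `kernelForm`. -/
noncomputable def offDiagForm [DecidableEq ι] (μ : Measure α) (S : Finset ι) (x : ι → α) : ℝ :=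
  ∑ k ∈ S, kernelSum μ (S.erase k) (x k) x

variable {μ : Measure α}

section Algebra

variable [DecidableEq ι]

theorem kernelForm_eq_offDiagForm_add (S : Finset ι) (x : ι → α) :
    kernelForm μ S x = offDiagForm μ S x + ∑ k ∈ S, (invProb μ (x k) - 1) := by
  rw [kernelForm, offDiagForm, ← Finset.sum_add_distrib]
  refine Finset.sum_congr rfl fun k hk => ?_
  rw [kernelSum, kernelSum, ← pearsonKernel_self, Finset.sum_erase_add _ _ hk]

theorem offDiagForm_insert {S : Finset ι} {k : ι} (hk : k ∉ S) (x : ι → α) :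
    offDiagForm μ (insert k S) x = offDiagForm μ S x + 2 * kernelSum μ S (x k) x := by
  have hold : ∀ j ∈ S, kernelSum μ ((insert k S).erase j) (x j) x
      = kernelSum μ (S.erase j) (x j) x + pearsonKernel μ (x k) (x j) := by
    intro j hj
    rw [Finset.erase_insert_of_ne (ne_of_mem_of_not_mem hj hk).symm, kernelSum, kernelSum,
      Finset.sum_insert (fun h => hk (Finset.mem_of_mem_erase h)), pearsonKernel_comm (x j),
      add_comm]
  rw [offDiagForm, Finset.sum_insert hk, Finset.erase_insert hk, Finset.sum_congr rfl hold,
    Finset.sum_add_distrib, offDiagForm, kernelSum]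
  ring

theorem kernelForm_insert {S : Finset ι} {k : ι} (hk : k ∉ S) (x : ι → α) :
    kernelForm μ (insert k S) x
      = kernelForm μ S x + 2 * kernelSum μ S (x k) x + (invProb μ (x k) - 1) := by
  rw [kernelForm_eq_offDiagForm_add, kernelForm_eq_offDiagForm_add, offDiagForm_insert hk,
    Finset.sum_insert hk]
  ring

theorem kernelSum_update {S : Finset ι} {k : ι} (hk : k ∉ S) (b : α) (x : ι → α) (a : α) :
    kernelSum μ S b (Function.update x k a) = kernelSum μ S b x :=
  sum_eval_update_of_notMem hk _ x a

theorem kernelForm_update {S : Finset ι} {k : ι} (hk : k ∉ S) (x : ι → α) (a : α) :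
    kernelForm μ S (Function.update x k a) = kernelForm μ S x := by
  simp only [kernelForm, kernelSum_update hk]
  exact sum_eval_update_of_notMem hk (kernelSum μ S · x) x a

theorem offDiagForm_update {S : Finset ι} {k : ι} (hk : k ∉ S) (x : ι → α) (a : α) :
    offDiagForm μ S (Function.update x k a) = offDiagForm μ S x := by
  have h := kernelForm_update (μ := μ) hk x a
  rwa [kernelForm_eq_offDiagForm_add, kernelForm_eq_offDiagForm_add,
    sum_eval_update_of_notMem hk fun b => invProb μ b - 1, add_left_inj] at h

end Algebra

variable [Finite α] [MeasurableSingletonClass α] [IsProbabilityMeasure μ]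

theorem integral_kernelSum_left (hμ : ∀ a, 0 < μ.real {a}) (S : Finset ι) (x : ι → α) :
    ∫ b, kernelSum μ S b x ∂μ = 0 := by
  simp only [kernelSum, pearsonKernel_comm _ (x _)]
  rw [integral_finsetSum _ fun _ _ => .of_finite]
  simp [integral_pearsonKernel hμ]

theorem integral_kernelSum_left_sq (hμ : ∀ a, 0 < μ.real {a}) (S : Finset ι) (x : ι → α) :
    ∫ b, kernelSum μ S b x ^ 2 ∂μ = kernelForm μ S x := by
  simp only [kernelSum, kernelForm, pow_two, Finset.sum_mul_sum]
  rw [integral_finsetSum _ fun _ _ => .of_finite]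
  refine Finset.sum_congr rfl fun k _ => ?_
  rw [integral_finsetSum _ fun _ _ => .of_finite]
  simp only [integral_pearsonKernel_mul_pearsonKernel hμ]

end KernelForms

section KernelMoments

variable {ι : Type*} [Fintype ι] {α : Type*} [DecidableEq α]
  [MeasurableSpace α] [MeasurableSingletonClass α] {μ : Measure α} [IsProbabilityMeasure μ]

section Finite

variable [Finite α]

theorem integral_kernelSum_right (hμ : ∀ a, 0 < μ.real {a}) (S : Finset ι) (a : α) :
    ∫ x, kernelSum μ S a x ∂Measure.pi (fun _ : ι => μ) = 0 :=
  (integral_pi_sum _ S).trans (by rw [integral_pearsonKernel hμ, mul_zero])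

theorem integral_kernelSum_right_sq (hμ : ∀ a, 0 < μ.real {a}) (S : Finset ι) (a : α) :
    ∫ x, kernelSum μ S a x ^ 2 ∂Measure.pi (fun _ : ι => μ) = S.card * (invProb μ a - 1) :=
  (integral_pi_sum_sq (integral_pearsonKernel hμ a) S).trans (by rw [integral_pearsonKernel_sq hμ])

theorem integral_kernelSum_right_pow_four_le (hμ : ∀ a, 0 < μ.real {a}) (S : Finset ι) (a : α) :
    ∫ x, kernelSum μ S a x ^ 4 ∂Measure.pi (fun _ : ι => μ)
      ≤ S.card * invProb μ a ^ 3 + 3 * S.card ^ 2 * invProb μ a ^ 2 := by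
  have hq := one_le_invProb hμ a
  calc ∫ x, kernelSum μ S a x ^ 4 ∂Measure.pi (fun _ : ι => μ)
      = S.card * ∫ b, pearsonKernel μ a b ^ 4 ∂μ
        + 3 * S.card * (S.card - 1) * (invProb μ a - 1) ^ 2 := by
        rw [← integral_pearsonKernel_sq hμ]
        exact integral_pi_sum_pow_four (integral_pearsonKernel hμ a) S
    _ ≤ S.card * invProb μ a ^ 3 + 3 * S.card * S.card * invProb μ a ^ 2 := by
        gcongr ?_ * ?_ + ?_ * ?_
        · exact integral_pearsonKernel_pow_four_le hμ a
        · gcongr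
          linarith
        · exact pow_le_pow_left₀ (by linarith) (by linarith) 2
    _ = _ := by ring

theorem integral_comp_kernelSum_eval {S : Finset ι} {k : ι} (hk : k ∉ S) (Φ : α → ℝ → ℝ) :
    ∫ x, Φ (x k) (kernelSum μ S (x k) x) ∂Measure.pi (fun _ : ι => μ)
      = ∫ a, ∫ x, Φ a (kernelSum μ S a x) ∂Measure.pi (fun _ : ι => μ) ∂μ := by
  classical
  exact integral_pi_eval_of_update_eq (μ := fun _ : ι => μ)
    (F := fun a x => Φ a (kernelSum μ S a x)) (fun b x a => by rw [kernelSum_update hk]) .of_finite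

theorem integral_kernelSum_eval_smul_eq_zero [DecidableEq ι] {S : Finset ι} {k : ι}
    {E : Type*} [NormedAddCommGroup E] [NormedSpace ℝ E] [CompleteSpace E]
    (hμ : ∀ a, 0 < μ.real {a}) (hk : k ∉ S) {A : (ι → α) → E}
    (hA : ∀ x a, A (Function.update x k a) = A x) :
    ∫ x, kernelSum μ S (x k) x • A x ∂Measure.pi (fun _ : ι => μ) = 0 := by
  rw [integral_pi_smul_of_update_eq (μ := fun _ : ι => μ) hA .of_finite]
  simp [kernelSum_update hk, integral_kernelSum_left hμ]

theorem integral_eval_mul_kernelSum_eval {S : Finset ι} {k : ι} (hμ : ∀ a, 0 < μ.real {a})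
    (hk : k ∉ S) (f : α → ℝ) :
    ∫ x, f (x k) * kernelSum μ S (x k) x ∂Measure.pi (fun _ : ι => μ) = 0 := by
  rw [integral_comp_kernelSum_eval hk fun a v => f a * v]
  simp [integral_const_mul, integral_kernelSum_right hμ]

end Finite

variable [Fintype α]

theorem integral_kernelSum_eval_sq {S : Finset ι} {k : ι} (hμ : ∀ a, 0 < μ.real {a}) (hk : k ∉ S) :
    ∫ x, kernelSum μ S (x k) x ^ 2 ∂Measure.pi (fun _ : ι => μ)
      = S.card * (Fintype.card α - 1) := by
  rw [integral_comp_kernelSum_eval hk fun _ v => v ^ 2]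
  simp only [integral_kernelSum_right_sq hμ]
  rw [integral_const_mul, integral_sub .of_finite .of_finite, integral_invProb hμ]
  simp

theorem integral_kernelForm_insert_sub_sq [DecidableEq ι] {S : Finset ι} {k : ι}
    (hμ : ∀ a, 0 < μ.real {a}) (hk : k ∉ S) :
    ∫ x, (kernelForm μ (insert k S) x - (S.card + 1) * (Fintype.card α - 1)) ^ 2
        ∂Measure.pi (fun _ : ι => μ)
      = ∫ x, (kernelForm μ S x - S.card * (Fintype.card α - 1)) ^ 2 ∂Measure.pi (fun _ : ι => μ)
        + 4 * (S.card * (Fintype.card α - 1)) + Var[invProb μ; μ] := by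
  set G : (ι → α) → ℝ := fun x => kernelForm μ S x - S.card * (Fintype.card α - 1)
  set K : (ι → α) → ℝ := fun x => kernelSum μ S (x k) x
  set d : α → ℝ := fun a => invProb μ a - Fintype.card α
  have hG : ∀ x a, G (Function.update x k a) = G x := fun x a => by
    simp only [G, kernelForm_update hk]
  have hexpand (x : ι → α) :
      (kernelForm μ (insert k S) x - (S.card + 1) * (Fintype.card α - 1)) ^ 2
        = G x ^ 2 + 4 * K x ^ 2 + d (x k) ^ 2 + 4 * (G x * K x) + 2 * (G x * d (x k))
          + 4 * (d (x k) * K x) := by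
    rw [kernelForm_insert hk]
    ring
  have hGK : ∫ x, G x * K x ∂Measure.pi (fun _ : ι => μ) = 0 := by
    simpa only [smul_eq_mul, mul_comm] using integral_kernelSum_eval_smul_eq_zero hμ hk hG
  have hGd : ∫ x, G x * d (x k) ∂Measure.pi (fun _ : ι => μ) = 0 := by
    rw [integral_pi_mul_eval_of_update_eq (μ := fun _ : ι => μ) hG .of_finite,
      integral_invProb_sub_card hμ, mul_zero]
  have hdK : ∫ x, d (x k) * K x ∂Measure.pi (fun _ : ι => μ) = 0 :=
    integral_eval_mul_kernelSum_eval hμ hk d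
  have hdd : ∫ x, d (x k) ^ 2 ∂Measure.pi (fun _ : ι => μ) = Var[invProb μ; μ] := by
    rw [integral_comp_eval (μ := fun _ : ι => μ) (f := fun a => d a ^ 2) .of_discrete,
      integral_invProb_sub_card_sq hμ]
  simp only [hexpand]
  repeat rw [integral_add .of_finite .of_finite]
  simp only [integral_const_mul]
  rw [integral_kernelSum_eval_sq hμ hk, hdd, hGK, hGd, hdK]
  ring

theorem integral_kernelForm_sub_sq (hμ : ∀ a, 0 < μ.real {a}) (S : Finset ι) :
    ∫ x, (kernelForm μ S x - S.card * (Fintype.card α - 1)) ^ 2 ∂Measure.pi (fun _ : ι => μ)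
      = 2 * S.card * (S.card - 1) * (Fintype.card α - 1) + S.card * Var[invProb μ; μ] := by
  classical
  induction S using Finset.induction_on with
  | empty => simp [kernelForm]
  | insert k S hk ih =>
    rw [Finset.card_insert_of_notMem hk]
    push_cast
    rw [integral_kernelForm_insert_sub_sq hμ hk, ih]
    ring

end KernelMoments

section LeaveOneOut

theorem two_mul_mul_le_mul_sq_add_sq_div {ε : ℝ} (hε : 0 < ε) (a b : ℝ) :
    2 * (a * b) ≤ ε * a ^ 2 + b ^ 2 / ε := by
  have hsq : ε * a ^ 2 + b ^ 2 / ε - 2 * (a * b) = ε * (a - b / ε) ^ 2 := by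
    field_simp
    ring
  have := mul_nonneg hε.le (sq_nonneg (a - b / ε))
  linarith

theorem integral_abs_le_add_integral_sq_div {Ω : Type*} [MeasurableSpace Ω] {P : Measure Ω}
    [IsProbabilityMeasure P] {Y : Ω → ℝ} (hY : MemLp Y 2 P) {ε : ℝ} (hε : 0 < ε) :
    ∫ ω, |Y ω| ∂P ≤ ε + (∫ ω, Y ω ^ 2 ∂P) / ε := by
  have hpoint (ω : Ω) : |Y ω| ≤ ε + Y ω ^ 2 / ε := by
    have := two_mul_mul_le_mul_sq_add_sq_div hε 1 |Y ω|
    rw [sq_abs] at this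
    linarith [abs_nonneg (Y ω)]
  have hsq := hY.integrable_sq.div_const ε
  calc ∫ ω, |Y ω| ∂P ≤ ∫ ω, (ε + Y ω ^ 2 / ε) ∂P :=
        integral_mono (hY.integrable one_le_two).abs ((integrable_const ε).add hsq) hpoint
    _ = ε + (∫ ω, Y ω ^ 2 ∂P) / ε := by
        rw [integral_add (integrable_const ε) hsq, integral_div]
        simp

variable {ι : Type*} [Fintype ι] {α : Type*} [DecidableEq α] [MeasurableSpace α]
  [MeasurableSingletonClass α] {μ : Measure α} [IsProbabilityMeasure μ]

section Finite

variable [Finite α]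

theorem integral_min_kernelSum_right_le_of_invProb_le (hμ : ∀ a, 0 < μ.real {a}) (S : Finset ι)
    {ε L : ℝ} (hε : 0 < ε) (c : ℝ) {a : α} (ha : invProb μ a ≤ L) :
    ∫ x, 2 * min ((c * kernelSum μ S a x) ^ 2) (|c * kernelSum μ S a x| ^ 3)
        ∂Measure.pi (fun _ : ι => μ)
      ≤ c ^ 2 * S.card * (ε * invProb μ a)
        + c ^ 4 * S.card * (L + 3 * S.card) * invProb μ a ^ 2 / ε := by
  have hq := one_le_invProb hμ a
  have hpoint (v : ℝ) : 2 * min (v ^ 2) (|v| ^ 3) ≤ ε * v ^ 2 + v ^ 4 / ε := by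
    have hyoung := two_mul_mul_le_mul_sq_add_sq_div hε |v| (|v| ^ 2)
    calc 2 * min (v ^ 2) (|v| ^ 3) ≤ 2 * (|v| * |v| ^ 2) := by
          rw [← pow_succ']
          gcongr
          exact min_le_right _ _
      _ ≤ ε * |v| ^ 2 + (|v| ^ 2) ^ 2 / ε := hyoung
      _ = ε * v ^ 2 + v ^ 4 / ε := by
          rw [sq_abs]
          ring
  calc _ ≤ ∫ x, (ε * (c * kernelSum μ S a x) ^ 2 + (c * kernelSum μ S a x) ^ 4 / ε)
          ∂Measure.pi (fun _ : ι => μ) :=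
        integral_mono .of_finite .of_finite fun x => hpoint _
    _ = ε * c ^ 2 * (S.card * (invProb μ a - 1))
          + c ^ 4 * (∫ x, kernelSum μ S a x ^ 4 ∂Measure.pi (fun _ : ι => μ)) / ε := by
        simp only [mul_pow]
        rw [integral_add .of_finite .of_finite, integral_div, integral_const_mul,
          integral_const_mul, integral_const_mul, integral_kernelSum_right_sq hμ, mul_assoc]
    _ ≤ ε * c ^ 2 * (S.card * invProb μ a)
          + c ^ 4 * (S.card * (L * invProb μ a ^ 2) + 3 * S.card ^ 2 * invProb μ a ^ 2) / ε := by
        gcongr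
        · linarith
        · refine (integral_kernelSum_right_pow_four_le hμ S a).trans ?_
          rw [pow_succ' (invProb μ a) 2]
          gcongr
    _ = _ := by ring

theorem integral_min_kernelSum_right_le_of_lt_invProb (hμ : ∀ a, 0 < μ.real {a}) (S : Finset ι)
    {L : ℝ} (hL : 0 < L) (c : ℝ) {a : α} (ha : L < invProb μ a) :
    ∫ x, 2 * min ((c * kernelSum μ S a x) ^ 2) (|c * kernelSum μ S a x| ^ 3)
        ∂Measure.pi (fun _ : ι => μ)
      ≤ c ^ 2 * S.card * (2 * invProb μ a ^ 2 / L) := by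
  calc _ ≤ ∫ x, 2 * (c * kernelSum μ S a x) ^ 2 ∂Measure.pi (fun _ : ι => μ) := by
        refine integral_mono .of_finite .of_finite fun x => ?_
        gcongr
        exact min_le_left _ _
    _ = c ^ 2 * S.card * (2 * (invProb μ a - 1)) := by
        simp only [mul_pow]
        rw [integral_const_mul, integral_const_mul, integral_kernelSum_right_sq hμ]
        ring
    _ ≤ c ^ 2 * S.card * (2 * invProb μ a ^ 2 / L) := by
        gcongr
        rw [le_div_iff₀ hL]
        nlinarith

end Finite

theorem integral_min_kernelSum_eval_le [Fintype α] {S : Finset ι} {k : ι}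
    (hμ : ∀ a, 0 < μ.real {a}) (hk : k ∉ S) {ε L : ℝ} (hε : 0 < ε) (hL : 0 < L) (c : ℝ) :
    ∫ x, 2 * min ((c * kernelSum μ S (x k) x) ^ 2) (|c * kernelSum μ S (x k) x| ^ 3)
        ∂Measure.pi (fun _ : ι => μ)
      ≤ c ^ 2 * S.card * (2 * (∫ a, invProb μ a ^ 2 ∂μ) / L)
        + (c ^ 2 * S.card * (ε * Fintype.card α)
          + c ^ 4 * S.card * (L + 3 * S.card) * (∫ a, invProb μ a ^ 2 ∂μ) / ε) := by
  have hbound (a : α) :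
      ∫ x, 2 * min ((c * kernelSum μ S a x) ^ 2) (|c * kernelSum μ S a x| ^ 3)
          ∂Measure.pi (fun _ : ι => μ)
        ≤ c ^ 2 * S.card * (2 * invProb μ a ^ 2 / L) + (c ^ 2 * S.card * (ε * invProb μ a)
          + c ^ 4 * S.card * (L + 3 * S.card) * invProb μ a ^ 2 / ε) := by
    have hq := one_le_invProb hμ a
    rcases le_or_gt (invProb μ a) L with ha | ha
    · exact (integral_min_kernelSum_right_le_of_invProb_le hμ S hε c ha).trans
        (le_add_of_nonneg_left (by positivity))
    · exact (integral_min_kernelSum_right_le_of_lt_invProb hμ S hL c ha).trans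
        (le_add_of_nonneg_right (by positivity))
  rw [integral_comp_kernelSum_eval hk fun _ v => 2 * min ((c * v) ^ 2) (|c * v| ^ 3)]
  refine (integral_mono .of_finite .of_finite hbound).trans_eq ?_
  rw [integral_add .of_finite .of_finite, integral_add .of_finite .of_finite]
  simp only [integral_const_mul, integral_div, integral_invProb hμ]

end LeaveOneOut

section SteinRate

/-- The rate of the normal approximation for `n` observations, `m` classes and
`V = Var p⁻¹`: a normal approximation with error
of order `ε` is available once the rate is at most `ε ^ 3`. -/
noncomputable def pearsonRate (n m V : ℝ) : ℝ :=
  n⁻¹ + m⁻¹ + m / n ^ 2 + V / (n * m)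

variable {n m V ε : ℝ}

theorem bounds_of_pearsonRate_le (hn : 0 ≤ n) (hm : 0 ≤ m) (hV : 0 ≤ V) {r : ℝ}
    (h : pearsonRate n m V ≤ r) : n⁻¹ ≤ r ∧ m⁻¹ ≤ r ∧ m / n ^ 2 ≤ r ∧ V / (n * m) ≤ r := by
  have h₁ := inv_nonneg.2 hn
  have h₂ := inv_nonneg.2 hm
  have h₃ : 0 ≤ m / n ^ 2 := by positivity
  have h₄ : 0 ≤ V / (n * m) := by positivity
  rw [pearsonRate] at h
  refine ⟨?_, ?_, ?_, ?_⟩ <;> linarith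

-- A class is rare when `p⁻¹ > (m + n) / ε`, a threshold for which both remainders are `O(ε)`.
theorem rare_class_term_le (hn : 0 < n) (hm : 0 < m) (hV : 0 ≤ V) (hε : 0 < ε) (hε1 : ε ≤ 1)
    (h : pearsonRate n m V ≤ ε ^ 3) : 2 * (m ^ 2 + V) / ((m + n) / ε) / m ≤ 4 * ε := by
  obtain ⟨-, -, -, hr⟩ := bounds_of_pearsonRate_le hn.le hm.le hV h
  have hV1 : V ≤ n * m := by
    rw [div_le_iff₀ (by positivity)] at hr
    exact hr.trans (mul_le_of_le_one_left (by positivity) (pow_le_one₀ hε.le hε1))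
  rw [div_div, div_le_iff₀ (by positivity)]
  calc 2 * (m ^ 2 + V) ≤ 4 * ((m + n) * m) := by nlinarith
    _ = 4 * ε * ((m + n) / ε * m) := by field_simp

theorem frequent_class_term_le (hn : 0 < n) (hm : 0 < m) (hV : 0 ≤ V) (hε : 0 < ε) (hε1 : ε ≤ 1)
    (h : pearsonRate n m V ≤ ε ^ 3) :
    2 * ((m + n) / ε + 3 * n) * (m ^ 2 + V) / (n ^ 2 * m ^ 2 * ε) ≤ 20 * ε := by
  obtain ⟨hinvn, hinvm, hmn, hr⟩ := bounds_of_pearsonRate_le hn.le hm.le hV h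
  have hε3 : ε ^ 3 ≤ 1 := pow_le_one₀ hε.le hε1
  have hprod {y : ℝ} (hy : 0 ≤ y) (hy' : y ≤ ε ^ 3) : V / (n * m) * y ≤ ε ^ 3 :=
    (mul_le_of_le_one_left hy (hr.trans hε3)).trans hy'
  have hrn := hprod (inv_nonneg.2 hn.le) hinvn
  have hrm := hprod (inv_nonneg.2 hm.le) hinvm
  calc 2 * ((m + n) / ε + 3 * n) * (m ^ 2 + V) / (n ^ 2 * m ^ 2 * ε)
      = 2 / ε * ((m / n ^ 2 + n⁻¹ + V / (n * m) * n⁻¹ + V / (n * m) * m⁻¹) / ε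
          + 3 * (n⁻¹ + V / (n * m) * m⁻¹)) := by
        field_simp
        ring
    _ ≤ 2 / ε * ((ε ^ 3 + ε ^ 3 + ε ^ 3 + ε ^ 3) / ε + 3 * (ε ^ 3 + ε ^ 3)) := by gcongr
    _ = 8 * ε + 12 * (ε * ε) := by
        field_simp
        ring
    _ ≤ 8 * ε + 12 * (ε * 1) := by gcongr
    _ = 20 * ε := by ring

theorem deviation_term_le (hn : 0 < n) (hm : 0 < m) (hV : 0 ≤ V) (hε : 0 < ε) (hε1 : ε ≤ 1)
    (h : pearsonRate n m V ≤ ε ^ 3) :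
    (4 * n ^ 2 * m + 2 * n * V + 2 * (n + m) ^ 2) / (n * m) ^ 2 / ε ≤ 14 * ε := by
  obtain ⟨hinvn, hinvm, -, hr⟩ := bounds_of_pearsonRate_le hn.le hm.le hV h
  have hε3 : ε ^ 3 ≤ 1 := pow_le_one₀ hε.le hε1
  have hm1 : m⁻¹ ≤ 1 := hinvm.trans hε3
  have hsum : m⁻¹ + n⁻¹ ≤ 2 := by linarith [hinvn.trans hε3]
  calc (4 * n ^ 2 * m + 2 * n * V + 2 * (n + m) ^ 2) / (n * m) ^ 2 / ε
      = (4 * m⁻¹ + 2 * (V / (n * m)) * m⁻¹ + 2 * ((m⁻¹ + n⁻¹) * (m⁻¹ + n⁻¹))) / ε := by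
        field_simp
    _ ≤ (4 * ε ^ 3 + 2 * ε ^ 3 * 1 + 2 * ((ε ^ 3 + ε ^ 3) * 2)) / ε := by gcongr
    _ = 14 * (ε * ε) := by
        field_simp
        ring
    _ ≤ 14 * (ε * 1) := by gcongr
    _ = 14 * ε := by ring

end SteinRate

theorem card_pos_of_isProbabilityMeasure {α : Type*} [Fintype α] [MeasurableSpace α]
    (μ : Measure α) [IsProbabilityMeasure μ] : 0 < Fintype.card α :=
  Fintype.card_pos_iff.2 (nonempty_of_isProbabilityMeasure μ)

section KernelStein

open Complex (I)

variable {ι : Type*} [Fintype ι] [DecidableEq ι] {α : Type*} [DecidableEq α]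
  [MeasurableSpace α] [MeasurableSingletonClass α] {μ : Measure α} [IsProbabilityMeasure μ]

section Finite

variable [Finite α] {S : Finset ι} {k : ι}

theorem integral_kernelSum_eval_mul_eq_zero (hμ : ∀ a, 0 < μ.real {a}) (hk : k ∉ S)
    {A : (ι → α) → ℂ} (hA : ∀ x a, A (Function.update x k a) = A x) (c : ℝ) :
    ∫ x, ((c * kernelSum μ S (x k) x : ℝ) : ℂ) * A x ∂Measure.pi (fun _ : ι => μ) = 0 := by
  simp only [← Complex.real_smul, mul_smul]
  rw [integral_smul, integral_kernelSum_eval_smul_eq_zero hμ hk hA, smul_zero]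

theorem integral_kernelSum_eval_sq_mul (hμ : ∀ a, 0 < μ.real {a}) (hk : k ∉ S)
    {A : (ι → α) → ℂ} (hA : ∀ x a, A (Function.update x k a) = A x) (c : ℝ) :
    ∫ x, (((c * kernelSum μ S (x k) x) ^ 2 : ℝ) : ℂ) * A x ∂Measure.pi (fun _ : ι => μ)
      = ∫ x, ((c ^ 2 * kernelForm μ S x : ℝ) : ℂ) * A x ∂Measure.pi (fun _ : ι => μ) := by
  simp only [← Complex.real_smul, mul_pow]
  rw [integral_pi_smul_of_update_eq (μ := fun _ : ι => μ) hA .of_finite]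
  simp only [Function.update_self, kernelSum_update hk, integral_const_mul,
    integral_kernelSum_left_sq hμ]

end Finite

variable [Fintype α]

theorem integral_kernelForm_erase_sub_sq_le (hμ : ∀ a, 0 < μ.real {a}) (k : ι) :
    ∫ x, (kernelForm μ (Finset.univ.erase k) x - Fintype.card ι * Fintype.card α) ^ 2
        ∂Measure.pi (fun _ : ι => μ)
      ≤ 4 * (Fintype.card ι : ℝ) ^ 2 * Fintype.card α + 2 * Fintype.card ι * Var[invProb μ; μ]
        + 2 * ((Fintype.card ι : ℝ) + Fintype.card α) ^ 2 := by
  have hn : (1 : ℝ) ≤ Fintype.card ι := mod_cast Fintype.card_pos_iff.2 ⟨k⟩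
  have hm : (1 : ℝ) ≤ Fintype.card α := mod_cast card_pos_of_isProbabilityMeasure μ
  have hS : ((Finset.univ.erase k).card : ℝ) = Fintype.card ι - 1 :=
    Finset.cast_card_erase_of_mem (Finset.mem_univ k)
  have hvar := integral_kernelForm_sub_sq hμ (Finset.univ.erase k)
  have hV := variance_nonneg (invProb μ) μ
  rw [hS] at hvar
  generalize (Fintype.card ι : ℝ) = n at hn hvar ⊢
  generalize (Fintype.card α : ℝ) = m at hm hvar ⊢
  calc ∫ x, (kernelForm μ (Finset.univ.erase k) x - n * m) ^ 2 ∂Measure.pi (fun _ : ι => μ)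
      ≤ ∫ x, (2 * (kernelForm μ (Finset.univ.erase k) x - (n - 1) * (m - 1)) ^ 2
          + 2 * (n + m - 1) ^ 2) ∂Measure.pi (fun _ : ι => μ) :=
        integral_mono .of_finite .of_finite fun x => by
          nlinarith [sq_nonneg
            (kernelForm μ (Finset.univ.erase k) x - (n - 1) * (m - 1) + (n + m - 1))]
    _ = 2 * (2 * (n - 1) * (n - 1 - 1) * (m - 1) + (n - 1) * Var[invProb μ; μ])
          + 2 * (n + m - 1) ^ 2 := by
        rw [integral_add .of_finite .of_finite, integral_const_mul, hvar]
        simp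
    _ ≤ 2 * (2 * n * n * m + n * Var[invProb μ; μ]) + 2 * (n + m) ^ 2 := by
        have hlead : (n - 1) * (n - 1 - 1) * (m - 1) ≤ n * n * m :=
          mul_le_mul (by nlinarith) (by linarith) (by linarith) (by positivity)
        gcongr 2 * ?_ + 2 * ?_ ^ 2
        · gcongr ?_ + ?_ * _
          · linarith
          · linarith
        · linarith
        · linarith
    _ = _ := by ring

variable {c ε : ℝ}

theorem integral_min_kernelSum_erase_le (hμ : ∀ a, 0 < μ.real {a}) (k : ι)
    (hc : c ^ 2 = 2 / ((Fintype.card ι : ℝ) ^ 2 * Fintype.card α)) (hε : 0 < ε) (hε1 : ε ≤ 1)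
    (hrate : pearsonRate (Fintype.card ι) (Fintype.card α) Var[invProb μ; μ] ≤ ε ^ 3) :
    ∫ x, 2 * min ((c * kernelSum μ (Finset.univ.erase k) (x k) x) ^ 2)
        (|c * kernelSum μ (Finset.univ.erase k) (x k) x| ^ 3) ∂Measure.pi (fun _ : ι => μ)
      ≤ 2 / Fintype.card ι * (25 * ε) := by
  have hn : (0 : ℝ) < Fintype.card ι := mod_cast Fintype.card_pos_iff.2 ⟨k⟩
  have hm : (0 : ℝ) < Fintype.card α := mod_cast card_pos_of_isProbabilityMeasure μ
  have hS : ((Finset.univ.erase k).card : ℝ) ≤ Fintype.card ι := mod_cast Finset.card_le_univ _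
  have hV := variance_nonneg (invProb μ) μ
  have hrare := rare_class_term_le hn hm hV hε hε1 hrate
  have hfrequent := frequent_class_term_le hn hm hV hε hε1 hrate
  have hmin := integral_min_kernelSum_eval_le hμ (Finset.notMem_erase k Finset.univ) hε
    (div_pos (add_pos hm hn) hε) c
  rw [integral_invProb_sq hμ, show c ^ 4 = (c ^ 2) ^ 2 by ring, hc] at hmin
  generalize (Fintype.card ι : ℝ) = n at *
  generalize (Fintype.card α : ℝ) = m at *
  generalize Var[invProb μ; μ] = V at *
  calc _ ≤ _ := hmin
    _ ≤ 2 / (n ^ 2 * m) * n * (2 * (m ^ 2 + V) / ((m + n) / ε))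
          + (2 / (n ^ 2 * m) * n * (ε * m)
            + (2 / (n ^ 2 * m)) ^ 2 * n * ((m + n) / ε + 3 * n) * (m ^ 2 + V) / ε) := by
        gcongr
    _ = 2 / n * (2 * (m ^ 2 + V) / ((m + n) / ε) / m + ε
          + 2 * ((m + n) / ε + 3 * n) * (m ^ 2 + V) / (n ^ 2 * m ^ 2 * ε)) := by
        field_simp
        ring
    _ ≤ 2 / n * (4 * ε + ε + 20 * ε) := by gcongr
    _ = 2 / n * (25 * ε) := by ring

theorem integral_abs_kernelForm_erase_sub_le (hμ : ∀ a, 0 < μ.real {a}) (k : ι)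
    (hc : c ^ 2 = 2 / ((Fintype.card ι : ℝ) ^ 2 * Fintype.card α)) (hε : 0 < ε) (hε1 : ε ≤ 1)
    (hrate : pearsonRate (Fintype.card ι) (Fintype.card α) Var[invProb μ; μ] ≤ ε ^ 3) :
    ∫ x, |c ^ 2 * kernelForm μ (Finset.univ.erase k) x - 2 / Fintype.card ι|
        ∂Measure.pi (fun _ : ι => μ)
      ≤ 2 / Fintype.card ι * (15 * ε) := by
  have hn : (0 : ℝ) < Fintype.card ι := mod_cast Fintype.card_pos_iff.2 ⟨k⟩
  have hm : (0 : ℝ) < Fintype.card α := mod_cast card_pos_of_isProbabilityMeasure μ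
  have hV := variance_nonneg (invProb μ) μ
  have hdev := integral_kernelForm_erase_sub_sq_le hμ k
  have hterm := deviation_term_le hn hm hV hε hε1 hrate
  generalize (Fintype.card ι : ℝ) = n at *
  generalize (Fintype.card α : ℝ) = m at *
  have hscale (x : ι → α) : |c ^ 2 * kernelForm μ (Finset.univ.erase k) x - 2 / n|
      = 2 / n * |(kernelForm μ (Finset.univ.erase k) x - n * m) / (n * m)| := by
    rw [hc, ← abs_of_pos (div_pos two_pos hn), ← abs_mul, abs_of_pos (div_pos two_pos hn)]
    congr 1
    field_simp
  calc _ = 2 / n * ∫ x, |(kernelForm μ (Finset.univ.erase k) x - n * m) / (n * m)|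
          ∂Measure.pi (fun _ : ι => μ) := by
        simp only [hscale]
        rw [integral_const_mul]
    _ ≤ 2 / n * (ε + (∫ x, (kernelForm μ (Finset.univ.erase k) x - n * m) ^ 2
          ∂Measure.pi (fun _ : ι => μ)) / (n * m) ^ 2 / ε) := by
        gcongr
        refine (integral_abs_le_add_integral_sq_div .of_discrete hε).trans_eq ?_
        simp only [div_pow, integral_div]
    _ ≤ 2 / n * (ε + 14 * ε) := by
        gcongr
        refine le_trans ?_ hterm
        gcongr
    _ = 2 / n * (15 * ε) := by ring

theorem integral_abs_kernelSum_erase_le (hμ : ∀ a, 0 < μ.real {a}) (k : ι)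
    (hc : c ^ 2 = 2 / ((Fintype.card ι : ℝ) ^ 2 * Fintype.card α)) (hε : 0 < ε) (hε1 : ε ≤ 1)
    (hrate : pearsonRate (Fintype.card ι) (Fintype.card α) Var[invProb μ; μ] ≤ ε ^ 3) :
    ∫ x, |c * kernelSum μ (Finset.univ.erase k) (x k) x| ∂Measure.pi (fun _ : ι => μ) ≤ 3 * ε := by
  have hn : (0 : ℝ) < Fintype.card ι := mod_cast Fintype.card_pos_iff.2 ⟨k⟩
  have hm : (0 : ℝ) < Fintype.card α := mod_cast card_pos_of_isProbabilityMeasure μ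
  have hS : ((Finset.univ.erase k).card : ℝ) ≤ Fintype.card ι := mod_cast Finset.card_le_univ _
  obtain ⟨hinvn, -⟩ := bounds_of_pearsonRate_le hn.le hm.le (variance_nonneg _ μ) hrate
  calc _ ≤ ε + (∫ x, (c * kernelSum μ (Finset.univ.erase k) (x k) x) ^ 2
          ∂Measure.pi (fun _ : ι => μ)) / ε := integral_abs_le_add_integral_sq_div .of_discrete hε
    _ = ε + 2 / ((Fintype.card ι : ℝ) ^ 2 * Fintype.card α)
          * ((Finset.univ.erase k).card * (Fintype.card α - 1)) / ε := by
        simp only [mul_pow]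
        rw [integral_const_mul, hc, integral_kernelSum_eval_sq hμ (Finset.notMem_erase k _)]
    _ ≤ ε + 2 / ((Fintype.card ι : ℝ) ^ 2 * Fintype.card α)
          * (Fintype.card ι * Fintype.card α) / ε := by
        gcongr ε + _ * ?_ / ε
        exact mul_le_mul_of_nonneg hS (sub_le_self _ zero_le_one) (Nat.cast_nonneg _) hm.le
    _ = ε + 2 * (Fintype.card ι : ℝ)⁻¹ / ε := by field_simp
    _ ≤ ε + 2 * ε ^ 3 / ε := by gcongr
    _ = ε + 2 * (ε * ε) := by field_simp
    _ ≤ ε + 2 * (ε * 1) := by gcongr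
    _ = 3 * ε := by ring

theorem norm_integral_kernelSum_erase_mul_exp_sub_le (hμ : ∀ a, 0 < μ.real {a}) (k : ι)
    (hc : c ^ 2 = 2 / ((Fintype.card ι : ℝ) ^ 2 * Fintype.card α)) (hε : 0 < ε) (hε1 : ε ≤ 1)
    (hrate : pearsonRate (Fintype.card ι) (Fintype.card α) Var[invProb μ; μ] ≤ ε ^ 3) (s : ℝ) :
    ‖∫ x, ((c * kernelSum μ (Finset.univ.erase k) (x k) x : ℝ) : ℂ)
          * Complex.exp ((s * (c / 2 * offDiagForm μ Finset.univ x) : ℝ) * I)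
          ∂Measure.pi (fun _ : ι => μ)
        - s * ((2 / Fintype.card ι : ℝ) : ℂ) * I
          * ∫ x, Complex.exp ((s * (c / 2 * offDiagForm μ Finset.univ x) : ℝ) * I)
            ∂Measure.pi (fun _ : ι => μ)‖
      ≤ (1 + s ^ 2) * (2 / Fintype.card ι * (43 * ε)) := by
  set S := Finset.univ.erase k
  have hk : k ∉ S := Finset.notMem_erase k _
  have hsplit (x : ι → α) : c / 2 * offDiagForm μ Finset.univ x
      = c / 2 * offDiagForm μ S x + c * kernelSum μ S (x k) x := by
    rw [← Finset.insert_erase (Finset.mem_univ k), offDiagForm_insert hk]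
    ring
  have hexp (x : ι → α) (a : α) :
      Complex.exp ((s * (c / 2 * offDiagForm μ S (Function.update x k a)) : ℝ) * I)
        = Complex.exp ((s * (c / 2 * offDiagForm μ S x) : ℝ) * I) := by
    rw [offDiagForm_update hk]
  simp only [hsplit]
  refine (norm_integral_mul_exp_sub_le (measurable_of_finite _).aemeasurable .of_discrete .of_finite
    (by positivity) (integral_kernelSum_eval_mul_eq_zero hμ hk hexp c)
    (integral_kernelSum_eval_sq_mul hμ hk hexp c)).trans ?_
  gcongr
  rw [integral_add .of_finite .of_finite, integral_add .of_finite .of_finite,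
    integral_const_mul (2 / (Fintype.card ι : ℝ))]
  calc _ ≤ 2 / (Fintype.card ι : ℝ) * (25 * ε) + 2 / Fintype.card ι * (15 * ε)
        + 2 / Fintype.card ι * (3 * ε) := by
        gcongr
        · exact integral_min_kernelSum_erase_le hμ k hc hε hε1 hrate
        · exact integral_abs_kernelForm_erase_sub_le hμ k hc hε hε1 hrate
        · exact integral_abs_kernelSum_erase_le hμ k hc hε hε1 hrate
    _ = 2 / Fintype.card ι * (43 * ε) := by ring

end KernelStein

section Standardized

open Complex (I)

theorem norm_charFun_map_add_sub_charFun_map_le {Ω : Type*} [MeasurableSpace Ω] {P : Measure Ω}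
    [IsProbabilityMeasure P] {W R : Ω → ℝ} (hW : AEMeasurable W P) (hR : Integrable R P) (t : ℝ) :
    ‖charFun (P.map fun ω => W ω + R ω) t - charFun (P.map W) t‖ ≤ |t| * ∫ ω, |R ω| ∂P := by
  have hint {Y : Ω → ℝ} (hY : AEMeasurable Y P) :
      Integrable (fun ω => Complex.exp (t * Y ω * I)) P :=
    .of_bound (C := 1) (by fun_prop) (.of_forall fun ω => by
      rw [← Complex.ofReal_mul, Complex.norm_exp_ofReal_mul_I])
  have hWR : AEMeasurable (fun ω => W ω + R ω) P := hW.add hR.aemeasurable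
  rw [charFun_apply_real, charFun_apply_real, integral_map hWR (by fun_prop),
    integral_map hW (by fun_prop), ← integral_sub (hint hWR) (hint hW), ← integral_const_mul]
  refine norm_integral_le_of_norm_le (hR.abs.const_mul _) (.of_forall fun ω => ?_)
  have hfactor : Complex.exp (t * (W ω + R ω : ℝ) * I) - Complex.exp (t * W ω * I)
      = Complex.exp ((t * W ω : ℝ) * I) * (Complex.exp ((t * R ω : ℝ) * I) - 1) := by
    rw [mul_sub, ← Complex.exp_add, mul_one]
    push_cast
    ring_nf
  rw [hfactor, norm_mul, Complex.norm_exp_ofReal_mul_I, one_mul, ← abs_mul]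
  exact norm_exp_ofReal_mul_I_sub_one_le _

variable {ι : Type*} [Fintype ι] {α : Type*} [Fintype α] [MeasurableSpace α]
  [MeasurableSingletonClass α] {μ : Measure α} [IsProbabilityMeasure μ]

theorem integral_sum_invProb_sub_sq (hμ : ∀ a, 0 < μ.real {a}) :
    ∫ x, (∑ k, (invProb μ (x k) - 1) - Fintype.card ι * Fintype.card α) ^ 2
        ∂Measure.pi (fun _ : ι => μ)
      = Fintype.card ι * Var[invProb μ; μ] + (Fintype.card ι : ℝ) ^ 2 := by
  set d : α → ℝ := fun a => invProb μ a - Fintype.card α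
  have hd : ∫ a, d a ∂μ = 0 := integral_invProb_sub_card hμ
  have hexpand (x : ι → α) :
      (∑ k, (invProb μ (x k) - 1) - Fintype.card ι * Fintype.card α : ℝ) ^ 2
        = (∑ k, d (x k)) ^ 2 - 2 * Fintype.card ι * ∑ k, d (x k) + (Fintype.card ι : ℝ) ^ 2 := by
    simp only [d, Finset.sum_sub_distrib, Finset.sum_const, Finset.card_univ, nsmul_eq_mul]
    ring
  simp only [hexpand]
  rw [integral_add .of_finite .of_finite, integral_sub .of_finite .of_finite, integral_const_mul,
    integral_pi_sum, integral_pi_sum_sq hd, hd, integral_invProb_sub_card_sq hμ]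
  simp

variable [Nonempty ι] {c ε : ℝ}

theorem integral_abs_sum_invProb_sub_le (hμ : ∀ a, 0 < μ.real {a}) (hε : 0 < ε) (hε1 : ε ≤ 1)
    (hrate : pearsonRate (Fintype.card ι) (Fintype.card α) Var[invProb μ; μ] ≤ ε ^ 3) :
    ∫ x, |(∑ k, (invProb μ (x k) - 1) - Fintype.card ι * Fintype.card α)
        / (Fintype.card ι * √(2 * Fintype.card α))| ∂Measure.pi (fun _ : ι => μ) ≤ 2 * ε := by
  have hn : (0 : ℝ) < Fintype.card ι := mod_cast Fintype.card_pos
  have hm : (0 : ℝ) < Fintype.card α := mod_cast card_pos_of_isProbabilityMeasure μ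
  obtain ⟨-, hinvm, -, hr⟩ := bounds_of_pearsonRate_le hn.le hm.le (variance_nonneg _ μ) hrate
  refine (integral_abs_le_add_integral_sq_div .of_discrete hε).trans ?_
  simp only [div_pow]
  rw [integral_div, integral_sum_invProb_sub_sq hμ, mul_pow, Real.sq_sqrt (by positivity)]
  generalize (Fintype.card ι : ℝ) = n at *
  generalize (Fintype.card α : ℝ) = m at *
  calc ε + (n * Var[invProb μ; μ] + n ^ 2) / (n ^ 2 * (2 * m)) / ε
      = ε + (Var[invProb μ; μ] / (n * m) + m⁻¹) / (2 * ε) := by field_simp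
    _ ≤ ε + (ε ^ 3 + ε ^ 3) / (2 * ε) := by gcongr
    _ = ε + ε * ε := by
        field_simp
        ring
    _ ≤ ε + ε * 1 := by gcongr
    _ = 2 * ε := by ring

variable [DecidableEq α]

theorem norm_integral_offDiagForm_mul_exp_sub_le [DecidableEq ι] (hμ : ∀ a, 0 < μ.real {a})
    (hc : c ^ 2 = 2 / ((Fintype.card ι : ℝ) ^ 2 * Fintype.card α)) (hε : 0 < ε) (hε1 : ε ≤ 1)
    (hrate : pearsonRate (Fintype.card ι) (Fintype.card α) Var[invProb μ; μ] ≤ ε ^ 3) (s : ℝ) :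
    ‖∫ x, ((c / 2 * offDiagForm μ Finset.univ x : ℝ) : ℂ)
          * Complex.exp ((s * (c / 2 * offDiagForm μ Finset.univ x) : ℝ) * I)
          ∂Measure.pi (fun _ : ι => μ)
        - s * I * ∫ x, Complex.exp ((s * (c / 2 * offDiagForm μ Finset.univ x) : ℝ) * I)
            ∂Measure.pi (fun _ : ι => μ)‖
      ≤ (1 + s ^ 2) * (43 * ε) := by
  set e : (ι → α) → ℂ := fun x =>
    Complex.exp ((s * (c / 2 * offDiagForm μ Finset.univ x) : ℝ) * I)
  set T : ι → (ι → α) → ℝ := fun k x => c * kernelSum μ (Finset.univ.erase k) (x k) x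
  have hn : (Fintype.card ι : ℝ) ≠ 0 := mod_cast Fintype.card_ne_zero
  have hW (x : ι → α) : ((c / 2 * offDiagForm μ Finset.univ x : ℝ) : ℂ) * e x
      = 1 / 2 * ∑ k, (T k x : ℂ) * e x := by
    rw [← Finset.sum_mul, ← Complex.ofReal_sum, ← Finset.mul_sum, ← offDiagForm]
    push_cast
    ring
  have hsum : ∫ x, ((c / 2 * offDiagForm μ Finset.univ x : ℝ) : ℂ) * e x
          ∂Measure.pi (fun _ : ι => μ) - s * I * ∫ x, e x ∂Measure.pi (fun _ : ι => μ)
      = 1 / 2 * ∑ k, (∫ x, (T k x : ℂ) * e x ∂Measure.pi (fun _ : ι => μ)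
          - s * ((2 / Fintype.card ι : ℝ) : ℂ) * I * ∫ x, e x ∂Measure.pi (fun _ : ι => μ)) := by
    simp only [hW]
    rw [integral_const_mul, integral_finsetSum _ fun _ _ => .of_finite, Finset.sum_sub_distrib,
      Finset.sum_const, Finset.card_univ, nsmul_eq_mul]
    push_cast
    field_simp
  rw [hsum, norm_mul]
  calc _ ≤ ‖(1 / 2 : ℂ)‖ * ∑ _k : ι, (1 + s ^ 2) * (2 / Fintype.card ι * (43 * ε)) := by
        gcongr
        exact norm_sum_le_of_le _ fun k _ =>
          norm_integral_kernelSum_erase_mul_exp_sub_le hμ k hc hε hε1 hrate s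
    _ = (1 + s ^ 2) * (43 * ε) := by
        rw [Finset.sum_const, Finset.card_univ, nsmul_eq_mul]
        norm_num
        field_simp

theorem norm_charFun_offDiagForm_sub_le [DecidableEq ι] (hμ : ∀ a, 0 < μ.real {a})
    (hc : c ^ 2 = 2 / ((Fintype.card ι : ℝ) ^ 2 * Fintype.card α)) (hε : 0 < ε) (hε1 : ε ≤ 1)
    (hrate : pearsonRate (Fintype.card ι) (Fintype.card α) Var[invProb μ; μ] ≤ ε ^ 3) (t : ℝ) :
    ‖charFun ((Measure.pi fun _ : ι => μ).map fun x => c / 2 * offDiagForm μ Finset.univ x) t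
        - Real.exp (-t ^ 2 / 2)‖ ≤ (1 + t ^ 2) * (43 * ε) * |t| := by
  refine norm_charFun_map_sub_exp_le .of_finite fun s hs => ?_
  refine (norm_integral_offDiagForm_mul_exp_sub_le hμ hc hε hε1 hrate s).trans ?_
  have := sq_le_sq.2 hs
  gcongr

theorem norm_charFun_kernelForm_sub_le (hμ : ∀ a, 0 < μ.real {a}) (hε : 0 < ε) (hε1 : ε ≤ 1)
    (hrate : pearsonRate (Fintype.card ι) (Fintype.card α) Var[invProb μ; μ] ≤ ε ^ 3) (t : ℝ) :
    ‖charFun ((Measure.pi fun _ : ι => μ).map fun x =>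
          (kernelForm μ Finset.univ x / Fintype.card ι - Fintype.card α)
            / √(2 * Fintype.card α)) t - Real.exp (-t ^ 2 / 2)‖
      ≤ (1 + t ^ 2) * |t| * (45 * ε) := by
  classical
  have hn : (0 : ℝ) < Fintype.card ι := mod_cast Fintype.card_pos
  have hm : (0 : ℝ) < Fintype.card α := mod_cast card_pos_of_isProbabilityMeasure μ
  set n : ℝ := (Fintype.card ι : ℝ)
  set m : ℝ := (Fintype.card α : ℝ)
  set c : ℝ := 2 / (n * √(2 * m))
  set R : (ι → α) → ℝ := fun x => (∑ k, (invProb μ (x k) - 1) - n * m) / (n * √(2 * m))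
  have hc : c ^ 2 = 2 / (n ^ 2 * m) := by
    rw [div_pow, mul_pow, Real.sq_sqrt (by positivity)]
    field_simp
  have hsplit (x : ι → α) : (kernelForm μ Finset.univ x / n - m) / √(2 * m)
      = c / 2 * offDiagForm μ Finset.univ x + R x := by
    rw [kernelForm_eq_offDiagForm_add]
    simp only [c, R]
    field_simp
    ring
  simp only [hsplit]
  calc _ ≤ |t| * ∫ x, |R x| ∂Measure.pi (fun _ : ι => μ) + (1 + t ^ 2) * (43 * ε) * |t| :=
        (norm_sub_le_norm_sub_add_norm_sub _ _ _).trans (add_le_add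
          (norm_charFun_map_add_sub_charFun_map_le (measurable_of_finite _).aemeasurable
            .of_finite t)
          (norm_charFun_offDiagForm_sub_le hμ hc hε hε1 hrate t))
    _ ≤ |t| * (2 * ε) + (1 + t ^ 2) * (43 * ε) * |t| := by
        gcongr
        exact integral_abs_sum_invProb_sub_le hμ hε hε1 hrate
    _ ≤ (1 + t ^ 2) * |t| * (45 * ε) := by
        nlinarith [mul_nonneg (mul_nonneg (abs_nonneg t) hε.le) (sq_nonneg t)]

end Standardized

section PearsonStatistic

theorem kernelForm_eq_sum_invProb_mul_sq {ι α : Type*} [Fintype α] [DecidableEq α]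
    [MeasurableSpace α] (μ : Measure α) (S : Finset ι) (x : ι → α) :
    kernelForm μ S x
      = ∑ a, invProb μ a * (∑ k ∈ S, if x k = a then (1 : ℝ) else 0) ^ 2 - (S.card : ℝ) ^ 2 := by
  have hpair (k l : ι) : pearsonKernel μ (x k) (x l)
      = ∑ a, invProb μ a * ((if x k = a then 1 else 0) * if x l = a then 1 else 0) - 1 := by
    rcases eq_or_ne (x k) (x l) with h | h <;> simp [pearsonKernel, h]
  have hsq (a : α) : invProb μ a * (∑ k ∈ S, if x k = a then (1 : ℝ) else 0) ^ 2
      = ∑ k ∈ S, ∑ l ∈ S,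
          invProb μ a * ((if x k = a then 1 else 0) * if x l = a then 1 else 0) := by
    rw [sq, Finset.sum_mul_sum]
    simp only [Finset.mul_sum]
  simp only [kernelForm, kernelSum, hpair, Finset.sum_sub_distrib, hsq]
  congr 1
  · exact (Finset.sum_congr rfl fun k _ => Finset.sum_comm).trans Finset.sum_comm
  · simp [sq]

variable {n m : ℕ} {Ω : Type*} {μ : Measure (Fin m)} [IsProbabilityMeasure μ]

theorem pearsonChiSq_eq_kernelForm_div (hμ : ∀ i, 0 < μ.real {i}) (hn : n ≠ 0)
    (X : Fin n → Ω → Fin m) (ω : Ω) :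
    pearsonChiSq (fun i => μ.real {i}) X ω = kernelForm μ Finset.univ (X · ω) / n := by
  have hn' : (n : ℝ) ≠ 0 := mod_cast hn
  set N : Fin m → ℝ := fun i => ∑ k, if X k ω = i then 1 else 0
  have hN : ∑ i, N i = n := by
    rw [Finset.sum_comm]
    simp
  have hprob : ∑ i, μ.real {i} = 1 := by
    simp
  have hterm (i : Fin m) : ((n : ℝ)⁻¹ * N i - μ.real {i}) ^ 2 / μ.real {i}
      = invProb μ i * N i ^ 2 / n ^ 2 - 2 / n * N i + μ.real {i} := by
    have := (hμ i).ne'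
    rw [invProb]
    field_simp
    ring
  rw [kernelForm_eq_sum_invProb_mul_sq, Finset.card_univ, Fintype.card_fin]
  simp only [pearsonChiSq, empFreq]
  rw [Finset.sum_congr rfl fun i _ => hterm i, Finset.sum_add_distrib, Finset.sum_sub_distrib,
    ← Finset.sum_div, ← Finset.mul_sum, hN, hprob]
  field_simp
  ring

theorem aemeasurable_pearsonChiSq [MeasurableSpace Ω] {P : Measure Ω} (p : Fin m → ℝ)
    {X : Fin n → Ω → Fin m} (hX : ∀ k, AEMeasurable (X k) P) :
    AEMeasurable (pearsonChiSq p X) P :=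
  (measurable_of_finite (pearsonChiSq p fun k (x : Fin n → Fin m) => x k)).comp_aemeasurable
    (aemeasurable_pi_lambda _ hX)

theorem norm_charFun_map_pearsonChiSq_sub_le [MeasurableSpace Ω] {P : Measure Ω}
    (hμ : ∀ i, 0 < μ.real {i}) (hn : n ≠ 0) {X : Fin n → Ω → Fin m}
    (hX : ∀ k, HasLaw (X k) μ P) (hindep : iIndepFun X P) {ε : ℝ} (hε : 0 < ε) (hε1 : ε ≤ 1)
    (hrate : pearsonRate n m Var[invProb μ; μ] ≤ ε ^ 3) (t : ℝ) :
    ‖charFun (P.map fun ω =>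
          (pearsonChiSq (fun i => μ.real {i}) X ω - m) / √(2 * (m : ℝ))) t
        - Real.exp (-t ^ 2 / 2)‖ ≤ (1 + t ^ 2) * |t| * (45 * ε) := by
  have : NeZero n := ⟨hn⟩
  have hlaw := hindep.hasLaw_pi hX
  have hmap := AEMeasurable.map_map_of_aemeasurable (g := fun x : Fin n → Fin m =>
    (kernelForm μ Finset.univ x / n - m) / √(2 * (m : ℝ)))
    (measurable_of_finite _).aemeasurable hlaw.aemeasurable
  rw [hlaw.map_eq] at hmap
  simp only [pearsonChiSq_eq_kernelForm_div hμ hn]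
  have hkernel := norm_charFun_kernelForm_sub_le (ι := Fin n) hμ hε hε1 (by simpa using hrate) t
  simp only [Fintype.card_fin] at hkernel
  rwa [hmap] at hkernel

end PearsonStatistic

section Limit

theorem tendsto_of_norm_sub_le_mul_of_le_pow {E : Type*} [SeminormedAddCommGroup E] {f : ℕ → E}
    {l : E} {r : ℕ → ℝ} {K : ℝ} {d : ℕ} (hr : Tendsto r atTop (𝓝 0))
    (h : ∀ᶠ n in atTop, ∀ ε, 0 < ε → ε ≤ 1 → r n ≤ ε ^ d → ‖f n - l‖ ≤ K * ε) :
    Tendsto f atTop (𝓝 l) := by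
  have hK : Tendsto (fun ε : ℝ => K * ε) (𝓝[>] 0) (𝓝 0) :=
    tendsto_nhdsWithin_of_tendsto_nhds (by simpa using (tendsto_id (x := 𝓝 (0 : ℝ))).const_mul K)
  refine Metric.tendsto_nhds.2 fun η hη => ?_
  obtain ⟨ε, hKε, hε, hε1⟩ :=
    ((hK.eventually_lt_const hη).and (Ioc_mem_nhdsGT one_pos)).exists
  filter_upwards [h, hr.eventually_lt_const (pow_pos hε d)] with n hn hrn
  rw [dist_eq_norm]
  exact (hn ε hε hε1 hrn.le).trans_lt hKε

theorem tendsto_pearsonRate {m : ℕ → ℕ} {V : ℕ → ℝ} (hm : Tendsto m atTop atTop)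
    (hV : Tendsto (fun n : ℕ => ((m n : ℝ) * n)⁻¹ * V n) atTop (𝓝 0))
    (hratio : Tendsto (fun n : ℕ => (n : ℝ) / √(m n : ℝ)) atTop atTop) :
    Tendsto (fun n : ℕ => pearsonRate n (m n) (V n)) atTop (𝓝 0) := by
  have hinvn : Tendsto (fun n : ℕ => (n : ℝ)⁻¹) atTop (𝓝 0) :=
    tendsto_inv_atTop_nhds_zero_nat
  have hmn := (hratio.inv_tendsto_atTop.pow 2)
  have hsum := ((hinvn.add (hinvn.comp hm)).add hmn).add hV
  simp only [zero_pow two_ne_zero, add_zero] at hsum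
  refine hsum.congr fun n => ?_
  simp only [pearsonRate, Function.comp_apply, Pi.inv_apply, inv_div, div_pow,
    Real.sq_sqrt (Nat.cast_nonneg (m n))]
  rw [div_eq_inv_mul (V n), mul_comm (n : ℝ) (m n)]

end Limit

theorem theorem2_general
    (m : ℕ → ℕ) (hm : Tendsto m atTop atTop)
    (p : ∀ n : ℕ, Fin (m n) → ℝ) (hp : ∀ n, 1 ≤ n → ∀ i, 0 < p n i)
    {Ω₀ : ℕ → Type*} [∀ n, MeasurableSpace (Ω₀ n)]
    (P₀ : ∀ n, Measure (Ω₀ n)) [∀ n, IsProbabilityMeasure (P₀ n)]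
    (X₀ : ∀ n, Ω₀ n → Fin (m n))
    (hX₀ : ∀ n, 1 ≤ n → ∀ i, (P₀ n).real {ω | X₀ n ω = i} = p n i)
    {Ω : ℕ → Type*} [∀ n, MeasurableSpace (Ω n)]
    (P : ∀ n, Measure (Ω n)) [∀ n, IsProbabilityMeasure (P n)]
    (X : ∀ n, Fin n → Ω n → Fin (m n))
    (hident : ∀ n k, IdentDistrib (X n k) (X₀ n) (P n) (P₀ n))
    (hindep : ∀ n, 1 ≤ n → iIndepFun (X n) (P n))
    (hC : Tendsto
      (fun n : ℕ => ((m n : ℝ) * n)⁻¹ * Var[fun ω => (p n (X₀ n ω))⁻¹; P₀ n]) atTop (𝓝 0))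
    (hratio : Tendsto (fun n : ℕ => (n : ℝ) / √(m n : ℝ)) atTop atTop)
    {Ω' : Type*} [MeasurableSpace Ω'] (P' : Measure Ω') [IsProbabilityMeasure P']
    (N : Ω' → ℝ) (hN : HasLaw N (gaussianReal 0 1) P') :
    TendstoInDistribution
      (fun (n : ℕ) ω => (pearsonChiSq (p n) (X n) ω - m n) / √(2 * (m n : ℝ)))
      atTop N P P' := by
  let μ (n : ℕ) : Measure (Fin (m n)) := (P₀ n).map (X₀ n)
  have hX₀m (n : ℕ) (hn : 1 ≤ n) : AEMeasurable (X₀ n) (P₀ n) := (hident n ⟨0, hn⟩).aemeasurable_snd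
  have hμp (n : ℕ) (hn : 1 ≤ n) : (fun i => (μ n).real {i}) = p n := funext fun i =>
    (map_measureReal_apply_of_aemeasurable (hX₀m n hn) (.singleton i)).trans (hX₀ n hn i)
  have hV (n : ℕ) (hn : 1 ≤ n) :
      Var[invProb (μ n); μ n] = Var[fun ω => (p n (X₀ n ω))⁻¹; P₀ n] := by
    rw [variance_map (measurable_of_finite _).aemeasurable (hX₀m n hn), ← hμp n hn]
    rfl
  refine ⟨fun n => ?_, hN.aemeasurable,
    ProbabilityMeasure.tendsto_iff_tendsto_charFun.2 fun t => ?_⟩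
  · exact ((aemeasurable_pearsonChiSq _ fun k => (hident n k).aemeasurable_fst).sub_const _)
      |>.div_const _
  have hgauss : charFun (gaussianReal 0 1) t = Real.exp (-t ^ 2 / 2) := by
    simp [charFun_gaussianReal, neg_div]
  simp only [ProbabilityMeasure.coe_mk, hN.map_eq, hgauss]
  refine tendsto_of_norm_sub_le_mul_of_le_pow (d := 3) (K := (1 + t ^ 2) * |t| * 45)
    (tendsto_pearsonRate hm hC hratio) ?_
  filter_upwards [eventually_ge_atTop 1] with n hn ε hε hε1 hrate
  have := Measure.isProbabilityMeasure_map (hX₀m n hn)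
  have hbound := norm_charFun_map_pearsonChiSq_sub_le (μ := μ n)
    (fun i => (hp n hn i).trans_eq (congrFun (hμp n hn) i).symm) (Nat.one_le_iff_ne_zero.1 hn)
    (fun k => ⟨(hident n k).aemeasurable_fst, (hident n k).map_eq⟩) (hindep n hn) hε hε1
    (by rwa [hV n hn]) t
  rwa [hμp n hn, ← mul_assoc] at hbound

theorem theorem2
    (m : ℕ → ℕ) (hm : Tendsto m atTop atTop)
    (p : ∀ n : ℕ, Fin (m n) → ℝ) (hp : ∀ n, 1 ≤ n → ∀ i, 0 < p n i)
    -- the generic variables `X_n`, with `P(X_n = i) = p_n(i)`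
    {Ω₀ : ℕ → Type*} [∀ n, MeasurableSpace (Ω₀ n)]
    (P₀ : ∀ n, Measure (Ω₀ n)) [∀ n, IsProbabilityMeasure (P₀ n)]
    (X₀ : ∀ n, Ω₀ n → Fin (m n))
    (hX₀ : ∀ n, 1 ≤ n → ∀ i, (P₀ n).real {ω | X₀ n ω = i} = p n i)
    -- the rows of the array: `n` independent copies of `X_n`
    {Ω : ℕ → Type*} [∀ n, MeasurableSpace (Ω n)]
    (P : ∀ n, Measure (Ω n)) [∀ n, IsProbabilityMeasure (P n)]
    (X : ∀ n, Fin n → Ω n → Fin (m n))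
    (hident : ∀ n k, IdentDistrib (X n k) (X₀ n) (P n) (P₀ n))
    (hindep : ∀ n, 1 ≤ n → iIndepFun (X n) (P n))
    (hC : Tendsto
      (fun n : ℕ => ((m n : ℝ) * n)⁻¹ * Var[fun ω => (p n (X₀ n ω))⁻¹; P₀ n]) atTop (𝓝 0))
    (δ : ℝ) (hδ : 0 < δ)
    (hmom : BddAbove ((fun n : ℕ => (m n : ℝ) ^ (-(1 + δ)) *
      ∫ ω, (p n (X₀ n ω)) ^ (-(1 + δ)) ∂(P₀ n)) '' {n | 1 ≤ n}))
    (hratio : Tendsto (fun n : ℕ => (n : ℝ) / √(m n : ℝ)) atTop atTop)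
    {Ω' : Type*} [MeasurableSpace Ω'] (P' : Measure Ω') [IsProbabilityMeasure P']
    (N : Ω' → ℝ) (hN : HasLaw N (gaussianReal 0 1) P') :
    TendstoInDistribution
      (fun (n : ℕ) ω => (pearsonChiSq (p n) (X n) ω - m n) / √(2 * (m n : ℝ)))
      atTop N P P' :=
  theorem2_general m hm p hp P₀ X₀ hX₀ P X hident hindep hC hratio P' N hN
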